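/- Let $S\subset\mathbb{R}^2$ be a finite set of points in general position, meaning that for each $p\in S$ no two distinct points of $S$ are at the same distance from $p$. For an angle $0<\theta\le 2\pi$, the continuous Yao graph $cY(\theta)$ is the graph with vertex set $S$ in which two distinct points $p,q\in S$ are joined by an edge if, for $p$ or $q$ as apex, there is a closed cone of aperture $\theta$ and arbitrary orientation with that apex such that the other of the two points is the closest point of $S$ to the apex in that cone (the apex itself being disregarded). The spanning ratio of a graph on $S$ is the smallest $t$ such that for all $p,q\in S$ the length of a shortest path from $p$ to $q$ in the graph, where edges have their Euclidean lengths, is at most $t\,|pq|$. Let $t$ be the largest real root of the polynomial $$2x^{12}+6x^{11}-84x^{10}-204x^{9}+291x^{8}+216x^{7}-589x^{6}+138x^{5}+363x^{4}-246x^{3}-39x^{2}+90x-25;$$ it satisfies $6.0410<t<6.0411$. **Theorem.** The spanning ratio of $cY(2\pi/3)$ is at most $t$. Moreover, for every $0<\theta<2\pi/3$, the spanning ratio of $cY(\theta)$ is at most $\min\left\{t,\ \frac{1}{1-2\sin(\theta/4)}\right\}$. In particular, both statements hold with $6.0411$ in place of $t$. -/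

import Mathlib

open scoped ENNReal

noncomputable section

/-- The Euclidean plane. -/
abbrev Plane : Type := EuclideanSpace ℝ (Fin 2)

/-- The closed cone with apex `p`, aperture `θ`, and bisector in the direction `d`
(a nonzero vector), without its apex: all `x ≠ p` such that the unsigned angle at `p` between
the bisector and `x` is at most `θ / 2`. For `θ = 2 * π` this is the whole plane minus `p`. -/
def cone (θ : ℝ) (p d : Plane) : Set Plane :=
  {x | x ≠ p ∧ InnerProductGeometry.angle d (x - p) ≤ θ / 2}

/-- Some cone with apex `p` and aperture `θ` (of arbitrary orientation) has `q` as its closest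
point of `S` to `p`. -/
def IsYaoNeighbor (θ : ℝ) (S : Set Plane) (p q : Plane) : Prop :=
  ∃ d : Plane, d ≠ 0 ∧ q ∈ cone θ p d ∧ ∀ r ∈ S, r ∈ cone θ p d → dist p q ≤ dist p r

/-- The (undirected) continuous Yao graph `cY(θ)` with vertex set `S`. -/
def contYao (θ : ℝ) (S : Set Plane) : SimpleGraph S where
  Adj p q := p ≠ q ∧ (IsYaoNeighbor θ S p q ∨ IsYaoNeighbor θ S q p)
  symm := ⟨fun _ _ h => ⟨h.1.symm, h.2.symm⟩⟩
  loopless := ⟨fun _ h => h.1 rfl⟩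

/-- General position: no point of `S` has two distinct points of `S` at the same distance. -/
def GeneralPosition (S : Set Plane) : Prop :=
  ∀ p ∈ S, ∀ q ∈ S, ∀ r ∈ S, q ≠ r → dist p q ≠ dist p r

/-- The Euclidean length of a walk in a geometric graph: the sum of the lengths of its edges. -/
def walkLength {S : Set Plane} {G : SimpleGraph S} {p q : S} (w : G.Walk p q) : ℝ≥0∞ :=
  (w.darts.map fun e => edist (e.fst : Plane) (e.snd : Plane)).sum

/-- The length of a shortest path from `p` to `q` in `G` (`∞` if there is none). -/
def pathDist {S : Set Plane} (G : SimpleGraph S) (p q : S) : ℝ≥0∞ :=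
  ⨅ w : {w : G.Walk p q // w.IsPath}, walkLength w.1

/-- `G` is a geometric `t`-spanner of its vertex set `S`. -/
def IsGeometricSpanner {S : Set Plane} (G : SimpleGraph S) (t : ℝ≥0∞) : Prop :=
  ∀ p q : S, pathDist G p q ≤ t * edist (p : Plane) (q : Plane)

/-- The spanning ratio of `G`: the smallest `t ∈ [0, ∞]` for which `G` is a `t`-spanner. -/
def spanningRatio {S : Set Plane} (G : SimpleGraph S) : ℝ≥0∞ :=
  sInf {t | IsGeometricSpanner G t}

/-- The infimum in the definition of the spanning ratio is a minimum. -/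
theorem isLeast_spanningRatio {S : Set Plane} (G : SimpleGraph S) :
    IsLeast {t | IsGeometricSpanner G t} (spanningRatio G) := by
  have key : ∀ p : S, pathDist G p p = 0 := fun p =>
    le_antisymm (iInf_le_of_le ⟨SimpleGraph.Walk.nil, by simp⟩ (by simp [walkLength])) bot_le
  refine ⟨fun p q => ?_, fun t ht => sInf_le ht⟩
  by_cases hpq : p = q
  · subst hpq
    simp [key]
  have h0 : edist (p : Plane) (q : Plane) ≠ 0 := by
    simpa [edist_eq_zero, Subtype.ext_iff] using hpq
  have h1 : edist (p : Plane) (q : Plane) ≠ ∞ := edist_ne_top _ _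
  rw [← ENNReal.div_le_iff h0 h1]
  exact le_sInf fun t ht => (ENNReal.div_le_iff h0 h1).2 (ht p q)

open Polynomial in
/-- The integer polynomial of degree 12 whose largest real root is the bound. -/
def contYaoPoly : ℤ[X] :=
  2 * X ^ 12 + 6 * X ^ 11 - 84 * X ^ 10 - 204 * X ^ 9 + 291 * X ^ 8 + 216 * X ^ 7 - 589 * X ^ 6
    + 138 * X ^ 5 + 363 * X ^ 4 - 246 * X ^ 3 - 39 * X ^ 2 + 90 * X - 25

end

/-!
The polynomial is increasing on `[6, ∞)` because its Taylor expansion at `6` has a single negative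
coefficient, the constant one; so its largest real root `t` is the one between `6.0410` and
`6.0411`. Since `6 < t`, it suffices to bound the spanning ratio by `6` for aperture `2π/3`
(`spanningRatio_contYao_two_pi_div_three_le`). The bound passes to smaller apertures, since
`contYao θ` only gains edges when `θ` decreases (`contYao_anti`): a cone that has `q` as its closest
point contains a narrower cone with the same apex that contains `q`.

Both bounds on the spanning ratio are proved by induction on the distance of the two points `a`, `b`
(`spanningRatio_le_of_step`). For `θ < 2π/3`, the closest point `c` to `a` in the cone around the
direction of `b` satisfies `|cb| ≤ |ab| - (1 - 2 sin (θ / 4)) |ac|` (`dist_le_of_mem_cone`), as for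
ordinary Yao graphs.

For aperture `2π/3`, normalize to `a = (0, 0)`, `b = (1, 0)`. A neighbour `c` of `a` is suitable if
`|ac| + 6 |cb| ≤ 6`, for then the induction hypothesis applies to `c`, `b`; likewise at `b`. Let `d`
be the neighbour of `b` in the cone around the direction of `a`, and suppose that it is unsuitable.
Then it lies near the apex of one of the two equilateral triangles over `ab`
(`bounds_of_unsuitable`), by reflection the lower one. Now take the neighbour `c` of `a` in the cone
around the direction `(40, -9)`. This cone contains `b` and is turned so far down that it misses
every unsuitable point above the axis; so if `c` is unsuitable, it lies on the same side as `d`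
(`bounds_of_unsuitable_tilted`), and then `|ac| + 6 |cd| + |db| ≤ 6` (`detour_le`), so that the
induction hypothesis applies to `c`, `d`.
-/

/-! ### The polynomial -/

/-- Taylor expansion at `6`: only the constant coefficient is negative. -/
theorem aeval_contYaoPoly_add_six (y : ℝ) : Polynomial.aeval (y + 6) contYaoPoly =
    2 * y ^ 12 + 150 * y ^ 11 + 5064 * y ^ 10 + 101676 * y ^ 9 + 1350075 * y ^ 8
    + 12455784 * y ^ 7 + 81514355 * y ^ 6 + 378496470 * y ^ 5 + 1221925899 * y ^ 4
    + 2609783106 * y ^ 3 + 3306723333 * y ^ 2 + 1844792766 * y - 81418201 := by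
  simp only [contYaoPoly, map_add, map_sub, map_mul, map_pow, Polynomial.aeval_X, map_ofNat]
  ring

theorem exists_isGreatest_root_contYaoPoly :
    ∃ t : ℝ, IsGreatest {x : ℝ | Polynomial.aeval x contYaoPoly = 0} t ∧
      6.0410 < t ∧ t < 6.0411 := by
  have hmono : StrictMonoOn (fun y : ℝ => Polynomial.aeval (y + 6) contYaoPoly) (Set.Ici 0) := by
    intro x hx y _ hxy
    have hx : 0 ≤ x := hx
    simp only [aeval_contYaoPoly_add_six]
    gcongr
  have hcont : ContinuousOn (fun y : ℝ => Polynomial.aeval (y + 6) contYaoPoly)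
      (Set.Icc 0.0410 0.0411) := by
    simp only [aeval_contYaoPoly_add_six]
    fun_prop
  obtain ⟨y, hy, hy0⟩ := intermediate_value_Ioo (by norm_num) hcont
    (show (0 : ℝ) ∈ Set.Ioo _ _ by
      simp only [aeval_contYaoPoly_add_six]
      constructor <;> norm_num)
  refine ⟨y + 6, ⟨hy0, fun x hx => ?_⟩, by linarith [hy.1], by linarith [hy.2]⟩
  by_contra! hlt
  have hy' : 0 ≤ y := le_trans (by norm_num) hy.1.le
  have h := hmono (a := y) (b := x - 6) hy' (show 0 ≤ x - 6 by linarith) (by linarith)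
  simp only [sub_add_cancel] at h
  rw [show Polynomial.aeval x contYaoPoly = 0 from hx] at h
  exact h.ne hy0

/-! ### Closest points in cones -/

theorem exists_isYaoNeighbor {θ : ℝ} {S : Set Plane} (hS : S.Finite) {p q d : Plane}
    (hq : q ∈ S) (hd : d ≠ 0) (hqc : q ∈ cone θ p d) :
    ∃ r ∈ S, r ∈ cone θ p d ∧ dist p r ≤ dist p q ∧ IsYaoNeighbor θ S p r := by
  obtain ⟨r, ⟨hrS, hrc⟩, hr⟩ :=
    (hS.subset (Set.inter_subset_left (t := cone θ p d))).exists_minimalFor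
      (dist p) _ ⟨q, hq, hqc⟩
  have hmin : ∀ x ∈ S, x ∈ cone θ p d → dist p r ≤ dist p x := fun x hx hxc =>
    (le_total (dist p r) (dist p x)).elim id fun h => hr ⟨hx, hxc⟩ h
  exact ⟨r, hrS, hrc, hmin q hq hqc, d, hd, hrc, hmin⟩

theorem cone_subset_cone {θ θ' : ℝ} {p d d' : Plane}
    (h : InnerProductGeometry.angle d' d ≤ (θ' - θ) / 2) : cone θ p d ⊆ cone θ' p d' := by
  rintro x ⟨hx, hxd⟩
  refine ⟨hx, ?_⟩
  linarith [InnerProductGeometry.angle_le_angle_add_angle d' d (x - p)]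

/-- Intermediate directions: on the segment between two directions that are not opposite, every
splitting of the angle between them is attained. -/
theorem exists_angle_eq_add {x y : Plane} (hx : x ≠ 0) (hy : y ≠ 0) {β : ℝ} (hβ : 0 ≤ β)
    (hβy : β ≤ InnerProductGeometry.angle x y) (hπ : InnerProductGeometry.angle x y < Real.pi) :
    ∃ z : Plane, z ≠ 0 ∧ InnerProductGeometry.angle x z = β ∧
      InnerProductGeometry.angle x y = β + InnerProductGeometry.angle z y := by
  let f : ℝ → Plane := fun s => (1 - s) • x + s • y
  have hf : ∀ s ∈ Set.Icc (0 : ℝ) 1, f s ≠ 0 := by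
    rintro s ⟨h0, h1⟩ hs
    rcases h0.eq_or_lt with rfl | h0
    · simp [f, hx] at hs
    refine hπ.ne (InnerProductGeometry.angle_eq_pi_iff.2 ⟨hx, -((1 - s) / s), ?_, ?_⟩)
    · rcases h1.eq_or_lt with rfl | h1
      · simp [f, hy] at hs
      · exact neg_lt_zero.2 (div_pos (by linarith) h0)
    · have : s • y = -((1 - s) • x) := by
        rw [eq_neg_iff_add_eq_zero, add_comm]; exact hs
      rw [neg_smul, div_eq_inv_mul, mul_smul, ← smul_neg, ← this, smul_smul,
        inv_mul_cancel₀ h0.ne', one_smul]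
  have hcont : ContinuousOn (fun s => InnerProductGeometry.angle x (f s)) (Set.Icc 0 1) := by
    intro s hs
    refine ContinuousAt.continuousWithinAt ?_
    have h1 : ContinuousAt (fun s : ℝ => (x, f s)) s := by
      have : Continuous fun s : ℝ => (x, f s) := by fun_prop
      exact this.continuousAt
    exact ContinuousAt.comp (f := fun s : ℝ => (x, f s))
      (InnerProductGeometry.continuousAt_angle hx (hf s hs)) h1
  obtain ⟨s, hs, hsβ⟩ := intermediate_value_Icc zero_le_one hcont
    (show β ∈ Set.Icc _ _ from ⟨by simpa [f, hx] using hβ, by simpa [f] using hβy⟩)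
  refine ⟨f s, hf s hs, hsβ, ?_⟩
  rw [← hsβ]
  refine (InnerProductGeometry.angle_eq_angle_add_angle_iff (hf s hs)).2 (Or.inr ?_)
  rw [Submodule.mem_span_pair]
  exact ⟨⟨1 - s, by linarith [hs.2]⟩, ⟨s, hs.1⟩, rfl⟩

/-- A smaller cone that contains `q` fits into any larger cone that contains `q`. -/
theorem IsYaoNeighbor.anti {θ θ' : ℝ} {S : Set Plane} {p q : Plane} (hθ : 0 ≤ θ) (hle : θ ≤ θ')
    (hlt : θ' < 2 * Real.pi) (h : IsYaoNeighbor θ' S p q) : IsYaoNeighbor θ S p q := by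
  obtain ⟨d, hd, ⟨hqp, hqd⟩, hmin⟩ := h
  obtain ⟨z, hz, hdz, hzq⟩ : ∃ z : Plane, z ≠ 0 ∧
      InnerProductGeometry.angle d z ≤ (θ' - θ) / 2 ∧
      InnerProductGeometry.angle z (q - p) ≤ θ / 2 := by
    rcases le_total ((θ' - θ) / 2) (InnerProductGeometry.angle d (q - p)) with h | h
    · obtain ⟨z, hz, h1, h2⟩ := exists_angle_eq_add hd (sub_ne_zero.2 hqp)
        (by linarith : 0 ≤ (θ' - θ) / 2) h (by linarith)
      exact ⟨z, hz, h1.le, by linarith⟩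
    · refine ⟨q - p, sub_ne_zero.2 hqp, h, ?_⟩
      rw [InnerProductGeometry.angle_self (sub_ne_zero.2 hqp)]
      linarith
  exact ⟨z, hz, ⟨hqp, hzq⟩, fun r hr hrz => hmin r hr (cone_subset_cone hdz hrz)⟩

theorem contYao_anti {θ θ' : ℝ} (S : Set Plane) (hθ : 0 ≤ θ) (hle : θ ≤ θ')
    (hlt : θ' < 2 * Real.pi) : contYao θ' S ≤ contYao θ S := fun _ _ h =>
  ⟨h.1, h.2.imp (IsYaoNeighbor.anti hθ hle hlt) (IsYaoNeighbor.anti hθ hle hlt)⟩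

/-! ### Walks and the spanning ratio -/

theorem walkLength_append {S : Set Plane} {G : SimpleGraph S} {p q r : S} (v : G.Walk p q)
    (w : G.Walk q r) : walkLength (v.append w) = walkLength v + walkLength w := by
  simp [walkLength]

theorem walkLength_toWalk {S : Set Plane} {G : SimpleGraph S} {p q : S} (h : G.Adj p q) :
    walkLength h.toWalk = edist (p : Plane) q := by
  simp [walkLength]

theorem pathDist_le_walkLength {S : Set Plane} {G : SimpleGraph S} {p q : S} (w : G.Walk p q) :
    pathDist G p q ≤ walkLength w := by
  classical
  refine (iInf_le _ ⟨w.bypass, w.bypass_isPath⟩).trans ?_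
  exact (w.darts_bypass_sublist_darts.map _).sum_le_sum fun _ _ => zero_le

/-- If any two points can be joined by walks of length at most `T` times their distance as soon as
this holds for all closer pairs, then the spanning ratio is at most `T`. -/
theorem spanningRatio_le_of_step {S : Set Plane} (hS : S.Finite) (G : SimpleGraph S) (T : ℝ)
    (step : ∀ p q : S, p ≠ q →
      (∀ p' q' : S, dist p' q' < dist p q →
        ∃ w : G.Walk p' q', walkLength w ≤ ENNReal.ofReal (T * dist p' q')) →
      ∃ w : G.Walk p q, walkLength w ≤ ENNReal.ofReal (T * dist p q)) :
    spanningRatio G ≤ ENNReal.ofReal T := by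
  have : Finite S := hS
  have key : ∀ x : S × S,
      ∃ w : G.Walk x.1 x.2, walkLength w ≤ ENNReal.ofReal (T * dist x.1 x.2) := by
    have wf : WellFounded fun x y : S × S => dist x.1 x.2 < dist y.1 y.2 :=
      Finite.wellFounded_of_trans_of_irrefl (r := InvImage (· < ·) fun x : S × S => dist x.1 x.2)
    intro x
    induction x using wf.induction with
    | _ x ih =>
      obtain ⟨p, q⟩ := x
      by_cases hpq : p = q
      · subst hpq
        exact ⟨.nil, by simp [walkLength]⟩
      · exact step p q hpq fun p' q' h => ih (p', q') h
  refine sInf_le fun p q => ?_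
  obtain ⟨w, hw⟩ := key (p, q)
  refine (pathDist_le_walkLength w).trans (hw.trans_eq ?_)
  rw [ENNReal.ofReal_mul' dist_nonneg, edist_dist]
  rfl

theorem spanningRatio_anti {S : Set Plane} {G H : SimpleGraph S} (h : G ≤ H) :
    spanningRatio H ≤ spanningRatio G := by
  refine sInf_le_sInf fun t ht p q => le_trans ?_ (ht p q)
  refine le_iInf fun w => ?_
  refine (pathDist_le_walkLength (w.1.mapLe h)).trans_eq ?_
  simp [walkLength, SimpleGraph.Walk.mapLe]
  rfl

/-! ### Aperture below `2π/3` -/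

/-- The inequality behind the induction for Yao graphs: moving to a point of the cone at
distance `r` decreases the distance to the target by at least `(1 - 2 sin (θ / 4)) r`. -/
theorem dist_le_of_mem_cone {θ : ℝ} (h0 : 0 < θ) (hθ : θ < 2 * Real.pi / 3) {p q r : Plane}
    (hr : r ∈ cone θ p (q - p)) (hle : dist p r ≤ dist p q) :
    dist r q ≤ dist p q - (1 - 2 * Real.sin (θ / 4)) * dist p r := by
  have hpi := Real.pi_pos
  have hs0 : 0 < Real.sin (θ / 4) := Real.sin_pos_of_pos_of_lt_pi (by linarith) (by linarith)
  have hs1 : Real.sin (θ / 4) < 1 / 2 := by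
    rw [← Real.sin_pi_div_six]
    exact Real.sin_lt_sin_of_lt_of_le_pi_div_two (by linarith) (by linarith) (by linarith)
  have hcos : 1 - 2 * Real.sin (θ / 4) ^ 2 ≤
      Real.cos (InnerProductGeometry.angle (q - p) (r - p)) := by
    have : Real.cos (θ / 2) = 1 - 2 * Real.sin (θ / 4) ^ 2 := by
      rw [show θ / 2 = 2 * (θ / 4) by ring, Real.cos_two_mul, Real.cos_sq']; ring
    rw [← this]
    exact Real.cos_le_cos_of_nonneg_of_le_pi (InnerProductGeometry.angle_nonneg _ _)
      (by linarith) hr.2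
  have hinner := InnerProductGeometry.cos_angle_mul_norm_mul_norm (q - p) (r - p)
  have hsq := norm_sub_sq_real (q - p) (r - p)
  rw [sub_sub_sub_cancel_right, ← hinner] at hsq
  rw [dist_comm r q, dist_comm p r, dist_comm p q] at *
  rw [← dist_eq_norm, ← dist_eq_norm, ← dist_eq_norm] at hsq
  set s := Real.sin (θ / 4)
  set a := dist q p
  set b := dist r p
  have ha : 0 ≤ a := dist_nonneg
  have hb : 0 ≤ b := dist_nonneg
  refine abs_le_of_sq_le_sq' ?_ ?_ |>.2
  · rw [hsq]
    have h1 := mul_le_mul_of_nonneg_right hcos (mul_nonneg ha hb)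
    have h2 : 0 ≤ 4 * s * (1 - s) * (b * (a - b)) :=
      mul_nonneg (mul_nonneg (by linarith) (by linarith)) (mul_nonneg hb (by linarith))
    nlinarith
  · nlinarith

theorem spanningRatio_contYao_le {θ : ℝ} (h0 : 0 < θ) (hθ : θ < 2 * Real.pi / 3) {S : Set Plane}
    (hS : S.Finite) :
    spanningRatio (contYao θ S) ≤ ENNReal.ofReal (1 / (1 - 2 * Real.sin (θ / 4))) := by
  have hpi := Real.pi_pos
  have hk : 0 < 1 - 2 * Real.sin (θ / 4) := by
    have : Real.sin (θ / 4) < 1 / 2 := by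
      rw [← Real.sin_pi_div_six]
      exact Real.sin_lt_sin_of_lt_of_le_pi_div_two (by linarith) (by linarith) (by linarith)
    linarith
  refine spanningRatio_le_of_step hS _ _ fun p q hpq ih => ?_
  have hqp : (q : Plane) ≠ p := fun h => hpq (Subtype.ext h.symm)
  obtain ⟨r, hrS, hrc, hle, hY⟩ := exists_isYaoNeighbor (θ := θ) (p := p) (d := q - p) hS q.2
    (sub_ne_zero.2 hqp)
    ⟨hqp, by rw [InnerProductGeometry.angle_self (sub_ne_zero.2 hqp)]; linarith⟩
  have hdist := dist_le_of_mem_cone h0 hθ hrc hle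
  have hadj : (contYao θ S).Adj p ⟨r, hrS⟩ := ⟨fun h => hrc.1 (by rw [h]), Or.inl hY⟩
  have hpr : 0 < dist (p : Plane) r := dist_pos.2 hrc.1.symm
  obtain ⟨w, hw⟩ := ih ⟨r, hrS⟩ q (by
    change dist r (q : Plane) < dist (p : Plane) q
    linarith [mul_pos hk hpr])
  refine ⟨hadj.toWalk.append w, ?_⟩
  rw [walkLength_append, walkLength_toWalk, edist_dist]
  refine (add_le_add_right hw _).trans ?_
  rw [← ENNReal.ofReal_add dist_nonneg (mul_nonneg (by positivity) dist_nonneg)]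
  refine ENNReal.ofReal_le_ofReal ?_
  change dist (p : Plane) r + 1 / (1 - 2 * Real.sin (θ / 4)) * dist r (q : Plane) ≤
    1 / (1 - 2 * Real.sin (θ / 4)) * dist (p : Plane) q
  calc _ ≤ dist (p : Plane) r + 1 / (1 - 2 * Real.sin (θ / 4)) *
        (dist (p : Plane) q - (1 - 2 * Real.sin (θ / 4)) * dist (p : Plane) r) := by gcongr
    _ = _ := by field_simp; ring

/-! ### Aperture `2π/3`: the region of unsuitable neighbours -/

/-- A point at distances `r` from the origin and `ρ` from `(1, 0)` is unsuitable for a walk from the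
origin to `(1, 0)` if `6 < r + 6 * ρ`. Eliminating `ρ` gives the exterior of a limaçon. -/
theorem lt_of_unsuitable {x y r ρ : ℝ} (hr : r ^ 2 = x ^ 2 + y ^ 2)
    (hρ : ρ ^ 2 = (x - 1) ^ 2 + y ^ 2) (hr1 : r ≤ 1) (hbad : 6 < r + 6 * ρ) :
    72 * x < 35 * r ^ 2 + 12 * r := by
  nlinarith

/-- The unsuitable points `(x, h)` of the cone of aperture `2π/3` around the positive `x`-axis lie in
a small region at the apex of the equilateral triangle over the unit segment. -/
theorem bounds_of_unsuitable {x h s : ℝ} (hs : s ^ 2 = x ^ 2 + h ^ 2) (hs0 : 0 < s) (hs1 : s ≤ 1)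
    (hcone : s ≤ 2 * x) (hbad : 72 * x < 35 * s ^ 2 + 12 * s) (hh : 0 ≤ h) :
    0.34 ≤ x ∧ x ≤ 0.66 ∧ 0.51 ≤ h ∧ h ≤ 0.87 ∧ h ≤ 1.7321 * x := by
  have h1 : 24 / 35 < s := by
    by_contra! hc
    nlinarith
  have h2 : 72 * x < 47 * s := by nlinarith
  refine ⟨by linarith, by linarith, ?_, ?_, ?_⟩
  · refine abs_le_of_sq_le_sq' ?_ hh |>.2
    nlinarith
  · refine abs_le_of_sq_le_sq' ?_ (by norm_num) |>.2
    nlinarith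
  · refine abs_le_of_sq_le_sq' ?_ (by linarith) |>.2
    nlinarith

/-- The unsuitable points `(x, -z)` of the cone of aperture `2π/3` around the direction `(40, -9)`.
The tilt is large enough for the upper edge of the cone to miss the unsuitable points above the
axis, and small enough to keep those below the axis away from the origin. -/
theorem bounds_of_unsuitable_tilted {x z r : ℝ} (hr : r ^ 2 = x ^ 2 + z ^ 2) (hr0 : 0 < r)
    (hr1 : r ≤ 1) (hcone : 41 * r ≤ 2 * (40 * x + 9 * z))
    (hbad : 72 * x < 35 * r ^ 2 + 12 * r) :
    0.25 ≤ r ∧ 0.297 * r ≤ x ∧ x ≤ 0.653 * r ∧ 0.757 * r ≤ z ∧ z ≤ 0.956 * r := by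
  have hx1 : x ≤ 0.653 * r := by nlinarith
  have hz0 : 0 ≤ z := by
    by_contra! hz
    nlinarith
  have hx0 : 0.297 * r ≤ x := by
    by_contra! hx
    nlinarith
  refine ⟨?_, hx0, hx1, ?_, ?_⟩
  · by_contra! hc
    nlinarith
  · refine abs_le_of_sq_le_sq' ?_ hz0 |>.2
    nlinarith
  · refine abs_le_of_sq_le_sq' ?_ (by positivity) |>.2
    nlinarith

/-- On the circular arc of unsuitable directions, `z` lies above the chord. -/
theorem chord_bound {x z r : ℝ} (hr : r ^ 2 = x ^ 2 + z ^ 2) (hr0 : 0 < r)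
    (hx0 : 0.297 * r ≤ x) (hx1 : x ≤ 0.653 * r) (hz : 0 ≤ z) :
    1.119 * r - 0.5562 * x ≤ z := by
  refine abs_le_of_sq_le_sq' ?_ hz |>.2
  nlinarith

/-- The detour over an unsuitable point `(x, -z)` of the tilted cone at the origin and an unsuitable
point `(u, -h)` of the cone at `(1, 0)`, with legs of lengths `r`, `g` and `s`, is short. -/
theorem detour_le {x z r u h s g : ℝ} (hr : r ^ 2 = x ^ 2 + z ^ 2) (hr0 : 0.25 ≤ r) (hr1 : r ≤ 1)
    (hx0 : 0.297 * r ≤ x) (hx1 : x ≤ 0.653 * r) (hz0 : 0.757 * r ≤ z) (hz1 : z ≤ 0.956 * r)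
    (hs : s ≤ 1) (hu0 : 0.34 ≤ u) (hu1 : u ≤ 0.66) (hh0 : 0.51 ≤ h) (hh1 : h ≤ 0.87)
    (hhu : h ≤ 1.7321 * (1 - u)) (hg : g ^ 2 = (x - u) ^ 2 + (z - h) ^ 2) :
    r + 6 * g + s ≤ 6 := by
  suffices 6 * g ≤ 5 - r by linarith
  refine abs_le_of_sq_le_sq' ?_ (by linarith) |>.2
  have hr' : 0 < r := by linarith
  have hchord := chord_bound hr hr' hx0 hx1 (by nlinarith)
  -- `c` and `σ` are the cosine and sine of the direction towards `(x, z)`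
  obtain ⟨c, rfl⟩ : ∃ c, x = r * c := ⟨x / r, by field_simp⟩
  obtain ⟨σ, rfl⟩ : ∃ σ, z = r * σ := ⟨z / r, by field_simp⟩
  have hc0 : 0.297 ≤ c := le_of_mul_le_mul_left (by linarith) hr'
  have hc1 : c ≤ 0.653 := le_of_mul_le_mul_left (by linarith) hr'
  have hσ0 : 0.757 ≤ σ := le_of_mul_le_mul_left (by linarith) hr'
  have hσ1 : σ ≤ 0.956 := le_of_mul_le_mul_left (by linarith) hr'
  have hcσ : 1.119 - 0.5562 * c ≤ σ := le_of_mul_le_mul_left (by linarith) hr'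
  have hone : c ^ 2 + σ ^ 2 = 1 := mul_left_cancel₀ (pow_pos hr' 2).ne' (by linarith)
  -- the squares of `u` and `h` are bounded by their chords, which makes the rest linear in `u`, `h`
  have hu : u ^ 2 ≤ u - 0.2244 := by nlinarith
  have hh : h ^ 2 ≤ 1.38 * h - 0.4437 := by nlinarith
  have hA : 36 * (u ^ 2 + h ^ 2) - 20.3125 ≤ 18 * (c * u + σ * h) := by
    have h1 : (1.119 - 0.5562 * c) * h ≤ σ * h := by gcongr
    -- the estimate is now linear in `c`, so that only the two extreme directions matter
    have h2 : 0 ≤ 18 * (0.297 * u + (1.119 - 0.5562 * 0.297) * h) - 36 * (u + 1.38 * h)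
        + 44.3641 := by linarith
    have h3 : 0 ≤ 18 * (0.653 * u + (1.119 - 0.5562 * 0.653) * h) - 36 * (u + 1.38 * h)
        + 44.3641 := by linarith
    linarith [mul_nonneg (sub_nonneg.2 hc1) h2, mul_nonneg (sub_nonneg.2 hc0) h3]
  have hB : 20 + 36 * (u ^ 2 + h ^ 2) ≤ 72 * (c * u + σ * h) := by
    have h1 : (c - u) ^ 2 ≤ 0.37 ^ 2 := sq_le_sq.2 (abs_le_abs (by linarith) (by linarith))
    have h2 : (σ - h) ^ 2 ≤ 0.45 ^ 2 := sq_le_sq.2 (abs_le_abs (by linarith) (by linarith))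
    linarith
  have hg' : g ^ 2 = r ^ 2 - 2 * r * (c * u + σ * h) + (u ^ 2 + h ^ 2) := by
    rw [hg]
    linear_combination r ^ 2 * hone
  rw [mul_pow, hg']
  -- after bounding `r ^ 2` by its chord, the estimate is linear in `r`, with extremes `hA`, `hB`
  have hr2 : 0 ≤ (1 - r) * (r - 0.25) := mul_nonneg (by linarith) (by linarith)
  linarith [mul_nonneg (sub_nonneg.2 hr1) (sub_nonneg.2 hA),
    mul_nonneg (sub_nonneg.2 hr0) (sub_nonneg.2 hB)]

/-! ### Normalized coordinates -/

/-- Cartesian coordinates in which `a` is `(0, 0)` and `b` is `(1, 0)`, the unit of length being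
`dist a b`. In place of the map between vectors, `exists_cone` records what it is needed for: each
direction `(m, n)`, of length `k` in coordinates, is the bisector of cones of aperture `2π/3` that
are given by the usual inequality between inner product and norms. The orientation is free. -/
structure NormalizedCoordinates (a b : Plane) where
  X : Plane → ℝ
  Y : Plane → ℝ
  X_left : X a = 0
  Y_left : Y a = 0
  X_right : X b = 1
  Y_right : Y b = 0
  dist_eq : ∀ p q, dist p q = dist a b * √((X q - X p) ^ 2 + (Y q - Y p) ^ 2)
  exists_cone : ∀ m n k : ℝ, 0 < k → m ^ 2 + n ^ 2 = k ^ 2 → ∃ d : Plane, d ≠ 0 ∧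
    ∀ p q, q ∈ cone (2 * Real.pi / 3) p d ↔ q ≠ p ∧
      k * √((X q - X p) ^ 2 + (Y q - Y p) ^ 2) ≤ 2 * (m * (X q - X p) + n * (Y q - Y p))

theorem mem_cone_two_pi_div_three {p d q : Plane} (hd : d ≠ 0) :
    q ∈ cone (2 * Real.pi / 3) p d ↔ q ≠ p ∧ ‖d‖ * ‖q - p‖ ≤ 2 * inner ℝ d (q - p) := by
  refine and_congr_right fun hq => ?_
  have hpos : 0 < ‖d‖ * ‖q - p‖ := mul_pos (norm_pos_iff.2 hd) (norm_pos_iff.2 (sub_ne_zero.2 hq))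
  rw [show 2 * Real.pi / 3 / 2 = Real.pi / 3 by ring,
    ← Real.strictAntiOn_cos.le_iff_ge ⟨by positivity, by linarith [Real.pi_pos]⟩
      ⟨InnerProductGeometry.angle_nonneg _ _, InnerProductGeometry.angle_le_pi _ _⟩,
    Real.cos_pi_div_three, InnerProductGeometry.cos_angle, le_div_iff₀ hpos]
  constructor <;> intro h <;> linarith

theorem NormalizedCoordinates.nonempty {a b : Plane} (hab : a ≠ b) :
    Nonempty (NormalizedCoordinates a b) := by
  obtain ⟨v₀, hv₀⟩ : ∃ v₀, v₀ = b 0 - a 0 := ⟨_, rfl⟩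
  obtain ⟨v₁, hv₁⟩ : ∃ v₁, v₁ = b 1 - a 1 := ⟨_, rfl⟩
  obtain ⟨L, hL⟩ : ∃ L, L = dist a b := ⟨_, rfl⟩
  have hLpos : 0 < L := hL ▸ dist_pos.2 hab
  have hLsq : L ^ 2 = v₀ ^ 2 + v₁ ^ 2 := by
    rw [hL, dist_comm, EuclideanSpace.dist_eq, Real.sq_sqrt (by positivity)]
    simp [Fin.sum_univ_two, Real.dist_eq, hv₀, hv₁]
  let X : Plane → ℝ := fun p => ((p 0 - a 0) * v₀ + (p 1 - a 1) * v₁) / L ^ 2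
  let Y : Plane → ℝ := fun p => ((p 1 - a 1) * v₀ - (p 0 - a 0) * v₁) / L ^ 2
  have hX : ∀ p q, X q - X p = ((q 0 - p 0) * v₀ + (q 1 - p 1) * v₁) / L ^ 2 := fun p q => by
    simp only [X]; ring
  have hY : ∀ p q, Y q - Y p = ((q 1 - p 1) * v₀ - (q 0 - p 0) * v₁) / L ^ 2 := fun p q => by
    simp only [Y]; ring
  have hdist : ∀ p q, dist p q = L * √((X q - X p) ^ 2 + (Y q - Y p) ^ 2) := fun p q => by
    conv_rhs => rw [← Real.sqrt_sq hLpos.le, ← Real.sqrt_mul (sq_nonneg _), hX, hY]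
    rw [dist_comm, EuclideanSpace.dist_eq]
    congr 1
    simp only [Fin.sum_univ_two, Real.dist_eq, sq_abs]
    field_simp
    rw [hLsq]
    ring
  refine ⟨⟨X, Y, by simp [X], by simp [Y], ?_, ?_, by rwa [← hL], fun m n k hk hmn => ?_⟩⟩
  · simp only [X, ← hv₀, ← hv₁]
    rw [div_eq_one_iff_eq (by positivity), hLsq]
    ring
  · simp only [Y, ← hv₀, ← hv₁]
    ring
  have hnorm : ‖(!₂[m * v₀ - n * v₁, m * v₁ + n * v₀] : Plane)‖ = k * L := by
    rw [EuclideanSpace.norm_eq, ← Real.sqrt_sq (by positivity : 0 ≤ k * L), mul_pow, ← hmn, hLsq]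
    congr 1
    simp [Fin.sum_univ_two]
    ring
  have hd : (!₂[m * v₀ - n * v₁, m * v₁ + n * v₀] : Plane) ≠ 0 := by
    rw [← norm_pos_iff, hnorm]
    positivity
  refine ⟨_, hd, fun p q => ?_⟩
  rw [mem_cone_two_pi_div_three hd]
  have hinner : inner ℝ (!₂[m * v₀ - n * v₁, m * v₁ + n * v₀] : Plane) (q - p) =
      L ^ 2 * (m * (X q - X p) + n * (Y q - Y p)) := by
    rw [hX, hY]
    simp [PiLp.inner_apply, Fin.sum_univ_two]
    field_simp
    ring
  rw [hinner, hnorm, ← dist_eq_norm, dist_comm, hdist]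
  refine and_congr_right fun _ => ?_
  rw [← mul_le_mul_iff_right₀ (pow_pos hLpos 2) (b := k * _)]
  constructor <;> intro h <;> linarith

/-- Reflection in the line through `a` and `b`. -/
def NormalizedCoordinates.reflect {a b : Plane} (F : NormalizedCoordinates a b) :
    NormalizedCoordinates a b where
  X := F.X
  Y p := -F.Y p
  X_left := F.X_left
  Y_left := by simp [F.Y_left]
  X_right := F.X_right
  Y_right := by simp [F.Y_right]
  dist_eq p q := by
    rw [F.dist_eq p q]
    congr 3
    ring
  exists_cone m n k hk hmn := by
    obtain ⟨d, hd, h⟩ := F.exists_cone m (-n) k hk (by linarith [neg_sq n])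
    refine ⟨d, hd, fun p q => ?_⟩
    rw [h, show (-F.Y q - -F.Y p) ^ 2 = (F.Y q - F.Y p) ^ 2 by ring,
      show -n * (F.Y q - F.Y p) = n * (-F.Y q - -F.Y p) by ring]

/-! ### The induction step for aperture `2π/3` -/

/-- The induction step: a walk from `a` to `c` and a walk from `d` to `b`, not both trivial, leave
the closer pair `c`, `d` to the induction hypothesis. -/
theorem exists_walk_of_detour {S : Set Plane} {G : SimpleGraph S} {a b c d : S}
    (ih : ∀ p q : S, dist p q < dist a b →
      ∃ w : G.Walk p q, walkLength w ≤ ENNReal.ofReal (6 * dist p q))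
    (u : G.Walk a c) (hu : walkLength u = edist (a : Plane) c)
    (v : G.Walk d b) (hv : walkLength v = edist (d : Plane) b)
    (hpos : 0 < dist (a : Plane) c + dist (d : Plane) b)
    (h : dist (a : Plane) c + 6 * dist (c : Plane) d + dist (d : Plane) b ≤
      6 * dist (a : Plane) b) :
    ∃ w : G.Walk a b, walkLength w ≤ ENNReal.ofReal (6 * dist a b) := by
  obtain ⟨w, hw⟩ := ih c d (by
    change dist (c : Plane) d < dist (a : Plane) b
    linarith)
  refine ⟨u.append (w.append v), ?_⟩
  rw [walkLength_append, walkLength_append, hu, hv, edist_dist, edist_dist]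
  refine (add_le_add_right (add_le_add_left hw _) _).trans ?_
  rw [← ENNReal.ofReal_add (by positivity) dist_nonneg,
    ← ENNReal.ofReal_add dist_nonneg (by positivity), ← add_assoc]
  exact ENNReal.ofReal_le_ofReal h

/-- Let `d` be the neighbour of `b` in the cone towards `a`, and reflect so that `d` lies below the
line `ab`. Unless `d` is suitable, it is near the apex of the lower equilateral triangle over `ab`.
Then the neighbour `c` of `a` in a cone that is turned downwards, and still contains `b`, either is
suitable or lies so close to `d` that the detour over `c` and `d` is short enough. -/
theorem spanningRatio_contYao_two_pi_div_three_le {S : Set Plane} (hS : S.Finite) :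
    spanningRatio (contYao (2 * Real.pi / 3) S) ≤ ENNReal.ofReal 6 := by
  refine spanningRatio_le_of_step hS _ _ fun a b hab ih => ?_
  have hab' : (a : Plane) ≠ b := fun h => hab (Subtype.ext h)
  have hL : 0 < dist (a : Plane) b := dist_pos.2 hab'
  obtain ⟨F₀⟩ := NormalizedCoordinates.nonempty hab'
  -- the neighbour `d` of `b` in the cone around the direction towards `a`
  obtain ⟨v, hv, hvc⟩ := F₀.exists_cone (-1) 0 1 one_pos (by norm_num)
  obtain ⟨d, hdS, hdc, hdle, hdY⟩ := exists_isYaoNeighbor hS a.2 hv ((hvc b a).2 ⟨hab', by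
    simp [F₀.X_left, F₀.X_right, F₀.Y_left, F₀.Y_right]⟩)
  have hadj_d : (contYao (2 * Real.pi / 3) S).Adj ⟨d, hdS⟩ b :=
    ⟨fun h => hdc.1 (congrArg Subtype.val h), Or.inr hdY⟩
  have hdc' := ((hvc b d).1 hdc).2
  obtain ⟨F, hdc', hFd⟩ : ∃ F : NormalizedCoordinates (a : Plane) b,
      √((F.X d - F.X b) ^ 2 + (F.Y d - F.Y b) ^ 2) ≤ 2 * (1 - F.X d) ∧ F.Y d ≤ 0 := by
    have h1 : √((F₀.X d - F₀.X b) ^ 2 + (F₀.Y d - F₀.Y b) ^ 2) ≤ 2 * (1 - F₀.X d) := by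
      have := F₀.X_right
      linarith
    rcases le_total (F₀.Y d) 0 with h | h
    · exact ⟨F₀, h1, h⟩
    · refine ⟨F₀.reflect, ?_, neg_nonpos.2 h⟩
      simpa [NormalizedCoordinates.reflect, F₀.Y_right] using h1
  have hXa := F.X_left
  have hYa := F.Y_left
  have hXb := F.X_right
  have hYb := F.Y_right
  -- `s`, `r`, ... are distances in units of `dist a b`
  obtain ⟨s, hs⟩ : ∃ s, s = √((F.X d - F.X b) ^ 2 + (F.Y d - F.Y b) ^ 2) := ⟨_, rfl⟩
  obtain ⟨σ, hσ⟩ : ∃ σ, σ = √((F.X d - F.X a) ^ 2 + (F.Y d - F.Y a) ^ 2) := ⟨_, rfl⟩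
  have hbd := F.dist_eq b d
  have had := F.dist_eq a d
  rw [← hs] at hdc' hbd
  rw [← hσ] at had
  have hs0 : 0 < s := pos_of_mul_pos_right (hbd ▸ dist_pos.2 hdc.1.symm) hL.le
  have hs1 : s ≤ 1 := by
    rw [dist_comm (b : Plane) a, hbd] at hdle
    exact le_of_mul_le_mul_left (by linarith) hL
  rcases le_or_gt (s + 6 * σ) 6 with hgood | hbad_d
  · refine exists_walk_of_detour ih .nil (by simp [walkLength]) hadj_d.toWalk
      (walkLength_toWalk _) (by rw [dist_self, zero_add]; exact dist_pos.2 hdc.1) ?_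
    change dist (a : Plane) a + 6 * dist (a : Plane) d + dist d (b : Plane) ≤
      6 * dist (a : Plane) b
    rw [dist_self, dist_comm d, had, hbd]
    linarith [mul_le_mul_of_nonneg_left hgood hL.le]
  obtain ⟨hu0, hu1, hh0, hh1, hhu⟩ := bounds_of_unsuitable (x := 1 - F.X d) (h := -F.Y d) (s := s)
    (by rw [hs, Real.sq_sqrt (by positivity), hXb, hYb]; ring) hs0 hs1 (by linarith)
    (lt_of_unsuitable (y := F.Y d) (ρ := σ)
      (by rw [hs, Real.sq_sqrt (by positivity), hXb, hYb]; ring)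
      (by rw [hσ, Real.sq_sqrt (by positivity), hXa, hYa]; ring) hs1 hbad_d) (by linarith)
  -- the neighbour `c` of `a` in a cone turned towards `d`
  obtain ⟨v', hv', hvc'⟩ := F.exists_cone 40 (-9) 41 (by norm_num) (by norm_num)
  obtain ⟨c, hcS, hcc, hcle, hcY⟩ := exists_isYaoNeighbor hS b.2 hv' ((hvc' a b).2 ⟨hab'.symm, by
    norm_num [F.X_left, F.X_right, F.Y_left, F.Y_right]⟩)
  have hadj_c : (contYao (2 * Real.pi / 3) S).Adj a ⟨c, hcS⟩ :=
    ⟨fun h => hcc.1 (congrArg Subtype.val h.symm), Or.inl hcY⟩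
  have hcc' := ((hvc' a c).1 hcc).2
  obtain ⟨r, hr⟩ : ∃ r, r = √((F.X c - F.X a) ^ 2 + (F.Y c - F.Y a) ^ 2) := ⟨_, rfl⟩
  obtain ⟨ρ, hρ⟩ : ∃ ρ, ρ = √((F.X b - F.X c) ^ 2 + (F.Y b - F.Y c) ^ 2) := ⟨_, rfl⟩
  obtain ⟨g, hg⟩ : ∃ g, g = √((F.X d - F.X c) ^ 2 + (F.Y d - F.Y c) ^ 2) := ⟨_, rfl⟩
  have hac := F.dist_eq a c
  have hcb := F.dist_eq c b
  have hcd := F.dist_eq c d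
  rw [← hr] at hcc' hac
  rw [← hρ] at hcb
  rw [← hg] at hcd
  have hr0 : 0 < r := pos_of_mul_pos_right (hac ▸ dist_pos.2 hcc.1.symm) hL.le
  have hr1 : r ≤ 1 := by
    rw [hac] at hcle
    exact le_of_mul_le_mul_left (by linarith) hL
  rcases le_or_gt (r + 6 * ρ) 6 with hgood | hbad_c
  · refine exists_walk_of_detour ih hadj_c.toWalk (walkLength_toWalk _) .nil
      (by simp [walkLength]) (by rw [dist_self, add_zero]; exact dist_pos.2 hcc.1.symm) ?_
    change dist (a : Plane) c + 6 * dist c (b : Plane) + dist (b : Plane) b ≤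
      6 * dist (a : Plane) b
    rw [dist_self, hac, hcb]
    linarith [mul_le_mul_of_nonneg_left hgood hL.le]
  have hr_sq : r ^ 2 = F.X c ^ 2 + F.Y c ^ 2 := by
    rw [hr, Real.sq_sqrt (by positivity), hXa, hYa]; ring
  have hr_sq' : r ^ 2 = F.X c ^ 2 + (-F.Y c) ^ 2 := by rw [hr_sq]; ring
  obtain ⟨hr0', hx0, hx1, hz0, hz1⟩ := bounds_of_unsuitable_tilted hr_sq' hr0 hr1
    (by rw [hXa, hYa] at hcc'; linarith)
    (lt_of_unsuitable (ρ := ρ) hr_sq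
      (by rw [hρ, Real.sq_sqrt (by positivity), hXb, hYb]; ring) hr1 hbad_c)
  have hdetour := detour_le (u := F.X d) (h := -F.Y d) (s := s) (g := g) hr_sq' hr0' hr1 hx0 hx1
    hz0 hz1 hs1 (by linarith) (by linarith) hh0 hh1 (by linarith)
    (by rw [hg, Real.sq_sqrt (by positivity)]; ring)
  refine exists_walk_of_detour ih hadj_c.toWalk (walkLength_toWalk _) hadj_d.toWalk
    (walkLength_toWalk _) (add_pos (dist_pos.2 hcc.1.symm) (dist_pos.2 hdc.1)) ?_
  change dist (a : Plane) c + 6 * dist c d + dist d (b : Plane) ≤ 6 * dist (a : Plane) b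
  rw [dist_comm d, hac, hcd, hbd]
  linarith [mul_le_mul_of_nonneg_left hdetour hL.le]

/-! ### The bounds on the spanning ratio -/

theorem mainTheorem2 :
    ∃ t : ℝ, IsGreatest {x : ℝ | Polynomial.aeval x contYaoPoly = 0} t ∧
      6.0410 < t ∧ t < 6.0411 ∧
      ∀ S : Set Plane, S.Finite → GeneralPosition S →
        spanningRatio (contYao (2 * Real.pi / 3) S) ≤ ENNReal.ofReal t ∧
        ∀ θ : ℝ, 0 < θ → θ < 2 * Real.pi / 3 →
          spanningRatio (contYao θ S) ≤
            ENNReal.ofReal (min t (1 / (1 - 2 * Real.sin (θ / 4)))) := by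
  obtain ⟨t, ht, ht0, ht1⟩ := exists_isGreatest_root_contYaoPoly
  refine ⟨t, ht, ht0, ht1, fun S hS _ => ?_⟩
  have h6 : spanningRatio (contYao (2 * Real.pi / 3) S) ≤ ENNReal.ofReal t :=
    (spanningRatio_contYao_two_pi_div_three_le hS).trans
      (ENNReal.ofReal_le_ofReal (by linarith))
  refine ⟨h6, fun θ h0 hθ => ?_⟩
  rw [ENNReal.ofReal_min]
  refine le_min ?_ (spanningRatio_contYao_le h0 hθ hS)
  exact (spanningRatio_anti (contYao_anti S h0.le hθ.le (by linarith [Real.pi_pos]))).trans h6
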